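/- **Theorem (S-OLS).** Let $\mathbf y=\mathbf X\boldsymbol\beta+\mathbf w$ with $\mathbf w\sim\mathcal N(0,\sigma^2\mathbf I_n)$, a fixed design $\mathbf X\in\mathbb R^{n\times p}$ and a fixed $\boldsymbol\beta\in\mathbb R^p$. Let $\boldsymbol\Sigma=\mathbf X^\top\mathbf X$ and let $\tilde{\mathbf X}\in\mathbb R^{n\times p}$ be a (fixed-X) knockoff matrix of $\mathbf X$, that is, for some $\mathbf s\in\mathbb R_+^p$, $$\mathbf G:=[\mathbf X\ \tilde{\mathbf X}]^\top[\mathbf X\ \tilde{\mathbf X}]=\begin{pmatrix}\boldsymbol\Sigma&\boldsymbol\Sigma-\operatorname{diag}(\mathbf s)\\ \boldsymbol\Sigma-\operatorname{diag}(\mathbf s)&\boldsymbol\Sigma\end{pmatrix},$$ and assume that $\mathbf G$ is invertible. Let $\delta\ge 0$, let $\boldsymbol\delta'\in\mathbb R^p$ be a fixed vector with $\delta'_i\ge\delta$ for all $1\le i\le p$, and let $$\begin{pmatrix}\hat{\boldsymbol\beta}\\ \hat{\boldsymbol\beta}'\end{pmatrix}=\mathbf G^{-1}[\mathbf X\ \tilde{\mathbf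 X}]^\top\mathbf y+\begin{pmatrix}0_{p\times1}\\ \boldsymbol\delta'\end{pmatrix}\in\mathbb R^{2p}$$ be the ordinary least-squares estimate over the augmented design $[\mathbf X\ \tilde{\mathbf X}]$ with the knockoff coefficients shifted by $\boldsymbol\delta'$. Given statistics $\boldsymbol W=(W_1,\dots,W_p)$ and a target level $q\in[0,1]$, the knockoff procedure selects $\hat{\mathcal S}=\{j:W_j\ge T\}$, where $$T=\inf\Big\{t\in\Psi:\ \frac{1+\#\{j:W_j\le -t\}}{\#\{j:W_j\ge t\}\vee1}\le q\Big\},\qquad \Psi=\{|W_i|:1\le i\le p\}\setminus\{0\},\qquad \inf\emptyset=+\infty.$$ For a set $\mathcal S_0\subseteq\{1,\dots,p\}$ of true nulls, its false discovery rate is $\mathrm{FDR}=\mathbb E\big[\,|\hat{\mathcal S}\cap\mathcal S_0|/\max(|\hat{\mathcal S}|,1)\big]$. **(I)** One-sided nulls: let $\mathcal S_0=\{j:\beta_j\le\delta\}$ and $W_j=\hat\beta_j-\hat\beta'_j$. Then $\mathrm{FDR}\le q$. **(II)** Two-sided nulls: let $\mathcal S_0=\{j:|\beta_j|\le\delta\}$,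 and let $\boldsymbol W$ be any measurable function of $(\hat{\boldsymbol\beta},\hat{\boldsymbol\beta}')$ that is anti-symmetric (for every $F\subseteq\{1,\dots,p\}$, swapping $\hat\beta_i$ and $\hat\beta'_i$ for all $i\in F$ switches the sign of $W_i$ for $i\in F$ and leaves the other $W_i$ unchanged) and satisfies $\operatorname{sgn}(W_j)=\operatorname{sgn}(|\hat\beta_j|-|\hat\beta'_j|)$ for all $j$. Then $$\mathrm{FDR}\le q+\mathbb P\Big\{\min_{j\in\mathcal S_0}\big(\hat\beta_j+\hat\beta'_j\big)<0\Big\},$$ where the minimum over an empty set is $+\infty$. -/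

import Mathlib

open MeasureTheory ProbabilityTheory

noncomputable section

/-- The augmented design `[X X̃]`; its columns are indexed by `Fin p ⊕ Fin p`, the column `inl j`
being the `j`-th feature and the column `inr j` (the `(j+p)`-th column) its knockoff. -/
def augmentedDesign {n p : ℕ} (X Xk : Matrix (Fin n) (Fin p) ℝ) :
    Matrix (Fin n) (Fin p ⊕ Fin p) ℝ :=
  Matrix.fromCols X Xk

/-- The Gram matrix `G = [X X̃]ᵀ [X X̃]` of the augmented design. -/
def augmentedGram {n p : ℕ} (X Xk : Matrix (Fin n) (Fin p) ℝ) :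
    Matrix (Fin p ⊕ Fin p) (Fin p ⊕ Fin p) ℝ :=
  (augmentedDesign X Xk).transpose * augmentedDesign X Xk

/-- `Xk` is a (fixed-X) knockoff matrix of the design `X` with parameter vector `s ≥ 0`: with
`Σ = Xᵀ X`, the Gram matrix of `[X Xk]` has diagonal blocks `Σ` and off-diagonal blocks
`Σ - diag s`. -/
structure IsKnockoff {n p : ℕ} (X Xk : Matrix (Fin n) (Fin p) ℝ) (s : Fin p → ℝ) : Prop where
  nonneg : ∀ i, 0 ≤ s i
  gram : augmentedGram X Xk =
    Matrix.fromBlocks (X.transpose * X) (X.transpose * X - Matrix.diagonal s)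
      (X.transpose * X - Matrix.diagonal s) (X.transpose * X)

/-- The response `y = X β + w` of the linear model. -/
def response {n p : ℕ} (X : Matrix (Fin n) (Fin p) ℝ) (β : Fin p → ℝ)
    (w : EuclideanSpace ℝ (Fin n)) : Fin n → ℝ :=
  fun i => X.mulVec β i + w i

/-- The ordinary least-squares estimate `(Aᵀ A)⁻¹ Aᵀ y`, used for `Aᵀ A` invertible. -/
def olsEstimate {n : ℕ} {κ : Type*} [Fintype κ] [DecidableEq κ] (A : Matrix (Fin n) κ ℝ)
    (y : Fin n → ℝ) : κ → ℝ :=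
  (A.transpose * A)⁻¹.mulVec (A.transpose.mulVec y)

/-- The shifted OLS estimate over the augmented design: the coefficients of the knockoff
variables are shifted by `δ'`. -/
def solsEstimate {n p : ℕ} (X Xk : Matrix (Fin n) (Fin p) ℝ) (δ' : Fin p → ℝ)
    (y : Fin n → ℝ) : Fin p ⊕ Fin p → ℝ :=
  olsEstimate (augmentedDesign X Xk) y + Sum.elim (fun _ => 0) δ'

/-- Swap the entries `inl i` and `inr i` of `b` for every `i ∈ F`. -/
def swapPairs {p : ℕ} (F : Finset (Fin p)) (b : Fin p ⊕ Fin p → ℝ) : Fin p ⊕ Fin p → ℝ :=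
  Sum.elim (fun i => if i ∈ F then b (Sum.inr i) else b (Sum.inl i))
    (fun i => if i ∈ F then b (Sum.inl i) else b (Sum.inr i))

/-- The statistics `W`, as a function of the estimates, are anti-symmetric: swapping the two
estimates of each pair in `F` switches the signs of `W i`, `i ∈ F`, and changes nothing else. -/
def IsAntisymmetric {p : ℕ} (W : (Fin p ⊕ Fin p → ℝ) → Fin p → ℝ) : Prop :=
  ∀ (F : Finset (Fin p)) (b : Fin p ⊕ Fin p → ℝ) (i : Fin p),
    W (swapPairs F b) i = if i ∈ F then -W b i else W b i

open Classical in
/-- `(1 + #{j : W j ≤ -t}) / (#{j : W j ≥ t} ∨ 1)`. -/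
def fdpHat {p : ℕ} (W : Fin p → ℝ) (t : ℝ) : ℝ :=
  (1 + ((Finset.univ.filter fun j => W j ≤ -t).card : ℝ)) /
    (max (Finset.univ.filter fun j => t ≤ W j).card 1 : ℕ)

/-- The knockoff threshold `T = inf {t ∈ Ψ : fdpHat t ≤ q}`, where `Ψ = {|W i|} \ {0}`;
the infimum is `⊤ = +∞` when there is no such `t`. -/
def knockoffThreshold {p : ℕ} (q : ℝ) (W : Fin p → ℝ) : EReal :=
  sInf ((fun t : ℝ => (t : EReal)) ''
    {t : ℝ | t ∈ (Set.range fun i => |W i|) \ {0} ∧ fdpHat W t ≤ q})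

open Classical in
/-- The selected set `{j : W j ≥ T}` of the knockoff procedure with target FDR `q`. -/
def knockoffSelect {p : ℕ} (q : ℝ) (W : Fin p → ℝ) : Finset (Fin p) :=
  Finset.univ.filter fun j => knockoffThreshold q W ≤ (W j : EReal)

open Classical in
/-- The false discovery proportion `|S ∩ S₀| / max(|S|, 1)` of the selected set `S`. -/
def falseDiscoveryProportion {p : ℕ} (S₀ : Set (Fin p)) (S : Finset (Fin p)) : ℝ :=
  ((S.filter fun j => j ∈ S₀).card : ℝ) / (max S.card 1 : ℕ)

/-- The false discovery rate, for the set `S₀` of true nulls, of the knockoff procedure with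
target FDR `q` run on the random statistics `W`. -/
def knockoffFDR {Ω : Type*} [MeasurableSpace Ω] (P : Measure Ω) {p : ℕ} (S₀ : Set (Fin p))
    (q : ℝ) (W : Ω → Fin p → ℝ) : ℝ :=
  ∫ ω, falseDiscoveryProportion S₀ (knockoffSelect q (W ω)) ∂P

/-- The minimum of `f` over `S₀`, equal to `⊤ = +∞` when `S₀` is empty. -/
def minOver {p : ℕ} (S₀ : Set (Fin p)) (f : Fin p → ℝ) : EReal :=
  ⨅ j ∈ S₀, (f j : EReal)

end

/-! Write `d` for the `j`-th column of `X` minus its knockoff. The contrast `e_j - e_{j+p}` is an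
eigenvector of `G` with eigenvalue `s j`, so reflecting the noise along `d` in a suitable affine
hyperplane swaps exactly the two shifted estimates of pair `j`, and antisymmetry flips the sign of
`W j` alone. Before noise the two estimates differ by `β j - δ' j`, which is at most `0` for a null.
The isotropic Gaussian therefore puts at least as much mass on the reflection of a set where the
first estimate exceeds the second as on the set itself (`lintegral_le_lintegral_comp_reflection`).

No joint sign symmetry is needed, because flips are made one at a time. The false discovery
proportion is at most `q` times the sum of `leaveOneOutWeight` over nulls with `W j > 0`. Each
weight ignores the sign of `W j`, so reflection bounds the expectation by that of the sum over nulls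
with `W j < 0`, which is at most `1` pointwise.

All this is done on a swap-invariant event `A` where `0 < W j` forces the first estimate to be the
larger; off `A` the proportion is bounded by `1`. Part (I) takes everything as `A`, part (II) the
event that all null pair sums are nonnegative. -/

/-! ### Gaussian mass under reflection -/

open scoped NNReal ENNReal RealInnerProductSpace in
lemma lintegral_gaussianReal_le_comp_reflection (v : ℝ≥0) {m : ℝ} (hm : m ≤ 0) {g : ℝ → ℝ≥0∞}
    (hg : Measurable g) (hsupp : ∀ x, g x ≠ 0 → 0 < m + 2 * x) :
    ∫⁻ x, g x ∂gaussianReal 0 v ≤ ∫⁻ x, g (-m - x) ∂gaussianReal 0 v := by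
  -- Zero variance (no noise) gives a point mass at `0`, where `m ≤ 0` forces `g` to vanish.
  by_cases hv : v = 0
  · subst hv
    have h0 : g 0 = 0 := by
      by_contra h
      have := hsupp 0 h
      linarith
    rw [gaussianReal_zero_var, lintegral_dirac' _ hg, h0]
    exact zero_le
  rw [gaussianReal_of_var_ne_zero _ hv,
    lintegral_withDensity_eq_lintegral_mul _ (measurable_gaussianPDF 0 v) hg,
    lintegral_withDensity_eq_lintegral_mul _ (measurable_gaussianPDF 0 v) (by fun_prop),
    ← lintegral_sub_left_eq_self _ (-m)]
  refine lintegral_mono fun x => ?_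
  simp only [Pi.mul_apply]
  by_cases hx : g (-m - x) = 0
  · simp [hx]
  have h := hsupp _ hx
  gcongr
  simp only [gaussianPDF, gaussianPDFReal]
  gcongr ENNReal.ofReal (_ * Real.exp (?_ / _))
  -- The density comparison is `x² ≤ (m + x)²`: the difference is `m * (m + 2 * x)`, and both
  -- factors are nonpositive on the support.
  nlinarith

open scoped NNReal ENNReal RealInnerProductSpace in
/-- A centred isotropic Gaussian measure puts more mass on the side of an affine hyperplane that
contains the origin: reflecting across the hyperplane `m + 2 ⟪d, x⟫ / ‖d‖ ^ 2 = 0`. -/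
lemma lintegral_le_lintegral_comp_reflection {E : Type*} [NormedAddCommGroup E]
    [InnerProductSpace ℝ E] [FiniteDimensional ℝ E] [MeasurableSpace E] [BorelSpace E]
    (μ : Measure E) [IsGaussian μ] (c : ℝ) (hmean : ∫ x, x ∂μ = 0)
    (hcov : ∀ x y : E, covarianceBilin μ x y = c * ⟪x, y⟫) {d : E} (hd : d ≠ 0) {m : ℝ}
    (hm : m ≤ 0) {f : E → ℝ≥0∞} (hf : Measurable f)
    (hsupp : ∀ x, f x ≠ 0 → 0 < m + 2 * (⟪d, x⟫ / ‖d‖ ^ 2)) :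
    ∫⁻ x, f x ∂μ ≤ ∫⁻ x, f (x - (m + 2 * (⟪d, x⟫ / ‖d‖ ^ 2)) • d) ∂μ := by
  have hd2 : ‖d‖ ^ 2 ≠ 0 := by positivity
  let L : E →L[ℝ] ℝ := (‖d‖ ^ 2)⁻¹ • innerSL ℝ d
  have hL : ∀ x, L x = ⟪d, x⟫ / ‖d‖ ^ 2 := fun x => by
    simp [L, div_eq_inv_mul]
  let Z : E →L[ℝ] E := ContinuousLinearMap.id ℝ E - L.smulRight d
  have hZ : ∀ x, Z x = x - L x • d := fun x => rfl
  have hLd : L d = 1 := by rw [hL, real_inner_self_eq_norm_sq, div_self hd2]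
  have hLZ : ∀ x, L (Z x) = 0 := fun x => by
    rw [hZ, map_sub, map_smul, hLd]; simp
  -- The coordinate along `d` and the orthogonal component are jointly Gaussian and uncorrelated by
  -- isotropy, hence independent. The reflection fixes `Z` and sends `L` to `-m - L`, so Fubini
  -- reduces the claim to dimension one.
  have hind : IndepFun L Z μ := by
    refine HasGaussianLaw.indepFun_of_covariance_inner ⟨?_⟩ fun a y => ?_
    · exact (inferInstance : IsGaussian (μ.map (L.prod Z)))
    have h1 : (fun x => ⟪a, L x⟫) = fun x => ⟪(a / ‖d‖ ^ 2) • d, x⟫ := by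
      ext x
      rw [hL, inner_smul_left]
      simp
      ring
    have h2 : (fun x => ⟪y, Z x⟫) = fun x => ⟪y - (⟪y, d⟫ / ‖d‖ ^ 2) • d, x⟫ := by
      ext x
      rw [hZ, hL, inner_sub_left, inner_sub_right, inner_smul_left, inner_smul_right]
      simp
      ring
    rw [h1, h2, ← covarianceBilin_apply_eq_cov IsGaussian.memLp_two_id, hcov, inner_sub_right,
      inner_smul_left, inner_smul_left, inner_smul_right, real_inner_self_eq_norm_sq,
      real_inner_comm]
    field_simp
    simp
  have hlaw : μ.map (fun x => (L x, Z x)) = (μ.map L).prod (μ.map Z) :=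
    (indepFun_iff_map_prod_eq_prod_map_map (by fun_prop) (by fun_prop)).1 hind
  have hLlaw : μ.map L = gaussianReal 0 (Var[L; μ]).toNNReal := by
    rw [IsGaussian.map_eq_gaussianReal, ContinuousLinearMap.integral_comp_id_comm, hmean, map_zero]
    exact IsGaussian.integrable_id
  have key : ∀ g : ℝ × E → ℝ≥0∞, Measurable g →
      ∫⁻ x, g (L x, Z x) ∂μ = ∫⁻ z, ∫⁻ t, g (t, z) ∂(μ.map L) ∂(μ.map Z) := fun g hg => by
    rw [← lintegral_prod_symm _ hg.aemeasurable, ← hlaw, lintegral_map hg (by fun_prop)]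
  have e1 : ∀ x, f x = f (Z x + L x • d) := fun x => by rw [hZ, sub_add_cancel]
  have e2 : ∀ x, f (x - (m + 2 * (⟪d, x⟫ / ‖d‖ ^ 2)) • d) = f (Z x + (-m - L x) • d) := fun x => by
    rw [hZ, ← hL]; congr 1; module
  -- the support condition only holds on the range of `Z`
  have hker : ∀ᵐ z ∂(μ.map Z), L z = 0 := by
    rw [ae_map_iff (by fun_prop) (measurableSet_eq_fun (by fun_prop) (by fun_prop))]
    exact ae_of_all _ hLZ
  simp_rw [e2]
  rw [lintegral_congr e1, key (fun p => f (p.2 + p.1 • d)) (by fun_prop),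
    key (fun p => f (p.2 + (-m - p.1) • d)) (by fun_prop)]
  refine lintegral_mono_ae ?_
  filter_upwards [hker] with z hz
  rw [hLlaw]
  refine lintegral_gaussianReal_le_comp_reflection _ hm (g := fun t => f (z + t • d))
    (by fun_prop) fun t ht => ?_
  have := hsupp _ ht
  rwa [← hL, map_add, hz, map_smul, hLd, smul_eq_mul, mul_one, zero_add] at this

/-! ### Deterministic leave-one-out bounds -/

section Threshold

variable {p : ℕ}

/-- There are finitely many candidate levels, so a finite infimum is attained. -/
lemma knockoffThreshold_eq_top_or (q : ℝ) (W : Fin p → ℝ) :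
    knockoffThreshold q W = ⊤ ∨ ∃ t : ℝ, knockoffThreshold q W = t ∧ 0 < t ∧
      t ∈ (Set.range fun i => |W i|) \ {0} ∧ fdpHat W t ≤ q := by
  set s : Set ℝ := {t : ℝ | t ∈ (Set.range fun i => |W i|) \ {0} ∧ fdpHat W t ≤ q} with hs
  have hT : knockoffThreshold q W = sInf ((fun t : ℝ => (t : EReal)) '' s) := rfl
  rcases s.eq_empty_or_nonempty with h | h
  · left
    rw [hT, h]
    simp
  · right
    have hfin : s.Finite :=
      (Set.finite_range fun i => |W i|).subset fun t ht => ht.1.1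
    obtain ⟨t, ht, hts⟩ := (h.image fun t : ℝ => (t : EReal)).csInf_mem (hfin.image _)
    refine ⟨t, by rw [hT, ← hts], ?_, ht⟩
    obtain ⟨⟨⟨i, rfl⟩, h0⟩, -⟩ := ht
    exact lt_of_le_of_ne (abs_nonneg _) (Ne.symm h0)

/-- The threshold of the knockoff procedure when the sign of `W j` is replaced by `+`. -/
noncomputable def leaveOneOutThreshold (q : ℝ) (W : Fin p → ℝ) (j : Fin p) : EReal :=
  knockoffThreshold q (Function.update W j |W j|)

open Classical in
/-- The weight `1{|W j| ≥ T j} / (1 + #{k ∈ S₀ \ {j} : W k ≤ -T j})`, where `T j` is the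
leave-one-out threshold. It does not depend on the sign of `W j`. -/
noncomputable def leaveOneOutWeight (S₀ : Set (Fin p)) (q : ℝ) (W : Fin p → ℝ) (j : Fin p) : ℝ :=
  if leaveOneOutThreshold q W j ≤ (|W j| : ℝ) then
    1 / (1 + ((Finset.univ.filter fun k =>
      k ∈ S₀ ∧ k ≠ j ∧ (W k : EReal) ≤ -leaveOneOutThreshold q W j).card : ℝ))
  else 0

lemma leaveOneOutWeight_nonneg (S₀ : Set (Fin p)) (q : ℝ) (W : Fin p → ℝ) (j : Fin p) :
    0 ≤ leaveOneOutWeight S₀ q W j := by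
  unfold leaveOneOutWeight
  split_ifs <;> positivity

lemma leaveOneOutThreshold_update_neg (q : ℝ) (W : Fin p → ℝ) (j : Fin p) :
    leaveOneOutThreshold q (Function.update W j (-W j)) j = leaveOneOutThreshold q W j := by
  simp [leaveOneOutThreshold]

lemma leaveOneOutWeight_update_neg (S₀ : Set (Fin p)) (q : ℝ) (W : Fin p → ℝ) (j : Fin p) :
    leaveOneOutWeight S₀ q (Function.update W j (-W j)) j = leaveOneOutWeight S₀ q W j := by
  unfold leaveOneOutWeight
  rw [leaveOneOutThreshold_update_neg]
  simp only [Function.update_self, abs_neg]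
  have h : ∀ k, (k ∈ S₀ ∧ k ≠ j ∧ ((Function.update W j (-W j) k : ℝ) : EReal) ≤
      -leaveOneOutThreshold q W j) ↔
      (k ∈ S₀ ∧ k ≠ j ∧ (W k : EReal) ≤ -leaveOneOutThreshold q W j) := fun k =>
    and_congr_right fun _ => and_congr_right fun hk => by rw [Function.update_of_ne hk]
  congr! 6
  exact h _

lemma abs_update_abs (W : Fin p → ℝ) (j i : Fin p) : |Function.update W j |W j| i| = |W i| := by
  rcases eq_or_ne i j with rfl | h
  · simp
  · rw [Function.update_of_ne h]

-- Making `W j` positive removes one negative, cancelling the `1 +`, and adds one positive. The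
-- resulting ratio no longer depends on `j`, which is why leave-one-out thresholds can be compared.
open Classical in
lemma fdpHat_update_abs {W : Fin p → ℝ} {j : Fin p} {t : ℝ} (hj : W j < 0) (ht : 0 < t)
    (htj : t ≤ |W j|) :
    fdpHat (Function.update W j |W j|) t =
      (Finset.univ.filter fun i => W i ≤ -t).card /
        (((Finset.univ.filter fun i => t ≤ W i).card + 1 : ℕ) : ℝ) := by
  have hle : W j ≤ -t := by rw [abs_of_neg hj] at htj; linarith
  have h1 : (Finset.univ.filter fun i => Function.update W j |W j| i ≤ -t) =
      (Finset.univ.filter fun i => W i ≤ -t).erase j := by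
    ext i
    rcases eq_or_ne i j with rfl | h
    · simp; linarith
    · simp [h]
  have h2 : (Finset.univ.filter fun i => t ≤ Function.update W j |W j| i) =
      insert j (Finset.univ.filter fun i => t ≤ W i) := by
    ext i
    rcases eq_or_ne i j with rfl | h
    · simpa using htj
    · simp [h]
  have hmem : j ∈ Finset.univ.filter fun i => W i ≤ -t := by simpa using hle
  have hnot : j ∉ Finset.univ.filter fun i => t ≤ W i := by simp; linarith
  unfold fdpHat
  rw [h1, h2, Finset.card_insert_of_notMem hnot, max_eq_left (by omega),
    ← Finset.card_erase_add_one hmem]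
  push_cast
  ring

/-- The level attaining the smaller threshold is below both `|W j|` and `|W k|`, where the two
modified ratios agree, so it is feasible for `k` as well. -/
lemma leaveOneOutThreshold_le_of_le {q : ℝ} {W : Fin p → ℝ} {j k : Fin p} (hj : W j < 0)
    (hk : W k < 0) (hTj : leaveOneOutThreshold q W j ≤ (|W j| : ℝ))
    (hTk : leaveOneOutThreshold q W k ≤ (|W k| : ℝ))
    (h : leaveOneOutThreshold q W j ≤ leaveOneOutThreshold q W k) :
    leaveOneOutThreshold q W k ≤ leaveOneOutThreshold q W j := by
  rcases knockoffThreshold_eq_top_or q (Function.update W j |W j|) with h1 | ⟨t, h1, ht, h2, h3⟩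
  · change leaveOneOutThreshold q W j = ⊤ at h1
    simp [h1]
  change leaveOneOutThreshold q W j = t at h1
  have htk := h.trans hTk
  rw [h1] at hTj htk ⊢
  rw [EReal.coe_le_coe_iff] at hTj htk
  refine sInf_le ⟨t, ⟨?_, ?_⟩, rfl⟩
  · simpa only [abs_update_abs] using h2
  · rwa [fdpHat_update_abs hk ht htk, ← fdpHat_update_abs hj ht hTj]

lemma leaveOneOutThreshold_eq {q : ℝ} {W : Fin p → ℝ} {j k : Fin p} (hj : W j < 0)
    (hk : W k < 0) (hTj : leaveOneOutThreshold q W j ≤ (|W j| : ℝ))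
    (hTk : leaveOneOutThreshold q W k ≤ (|W k| : ℝ)) :
    leaveOneOutThreshold q W j = leaveOneOutThreshold q W k := by
  rcases le_total (leaveOneOutThreshold q W j) (leaveOneOutThreshold q W k) with h | h
  · exact le_antisymm h (leaveOneOutThreshold_le_of_le hj hk hTj hTk h)
  · exact le_antisymm (leaveOneOutThreshold_le_of_le hk hj hTk hTj h) h

-- All contributing indices share one threshold, so the denominator of each weight counts every
-- other contributing index. Each weight is then at most the reciprocal of their number.
open Classical in
lemma sum_leaveOneOutWeight_neg_le_one (S₀ : Set (Fin p)) (q : ℝ) (W : Fin p → ℝ) :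
    ∑ j with j ∈ S₀, (if W j < 0 then leaveOneOutWeight S₀ q W j else 0) ≤ 1 := by
  set A := Finset.univ.filter fun j =>
    j ∈ S₀ ∧ W j < 0 ∧ leaveOneOutThreshold q W j ≤ (|W j| : ℝ) with hA
  have hsum : ∑ j with j ∈ S₀, (if W j < 0 then leaveOneOutWeight S₀ q W j else 0) =
      ∑ j ∈ A, leaveOneOutWeight S₀ q W j := by
    rw [← Finset.sum_filter, Finset.filter_filter]
    refine (Finset.sum_subset (fun j => ?_) fun j h1 h2 => ?_).symm
    · simp only [hA, Finset.mem_filter, Finset.mem_univ, true_and]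
      tauto
    · simp only [hA, Finset.mem_filter, Finset.mem_univ, true_and, not_and] at h1 h2
      exact if_neg (h2 h1.1 h1.2)
  rw [hsum]
  rcases A.eq_empty_or_nonempty with h0 | h0
  · simp [h0]
  have hpos : (0 : ℝ) < A.card := by exact_mod_cast h0.card_pos
  have hle : ∀ j ∈ A, leaveOneOutWeight S₀ q W j ≤ 1 / (A.card : ℝ) := fun j hj => by
    have hj' := hj
    simp only [hA, Finset.mem_filter, Finset.mem_univ, true_and] at hj'
    rw [leaveOneOutWeight, if_pos hj'.2.2]
    have hsub : A.erase j ⊆ Finset.univ.filter fun k =>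
        k ∈ S₀ ∧ k ≠ j ∧ (W k : EReal) ≤ -leaveOneOutThreshold q W j := fun k hk => by
      simp only [hA, Finset.mem_erase, Finset.mem_filter, Finset.mem_univ, true_and] at hk ⊢
      refine ⟨hk.2.1, hk.1, ?_⟩
      rw [leaveOneOutThreshold_eq hj'.2.1 hk.2.2.1 hj'.2.2 hk.2.2.2, EReal.le_neg]
      rw [← EReal.coe_neg, ← abs_of_neg hk.2.2.1]
      exact hk.2.2.2
    have hcard := Finset.card_le_card hsub
    rw [Finset.card_erase_of_mem hj] at hcard
    refine one_div_le_one_div_of_le hpos ?_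
    have : A.card ≤ 1 + (Finset.univ.filter fun k =>
        k ∈ S₀ ∧ k ≠ j ∧ (W k : EReal) ≤ -leaveOneOutThreshold q W j).card := by omega
    exact_mod_cast this
  calc ∑ j ∈ A, leaveOneOutWeight S₀ q W j ≤ ∑ _j ∈ A, 1 / (A.card : ℝ) := Finset.sum_le_sum hle
    _ = 1 := by rw [Finset.sum_const, nsmul_eq_mul, mul_one_div_cancel hpos.ne']

-- A selected `j` has `W j > 0`, so its leave-one-out threshold is `T` itself. Its weight is at
-- least `1 / M`, since it counts only part of the negatives in `M`, and `M / R ≤ q` is feasibility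
-- of `T`.
open Classical in
lemma falseDiscoveryProportion_le_sum_leaveOneOutWeight (S₀ : Set (Fin p)) {q : ℝ} (hq : 0 ≤ q)
    (W : Fin p → ℝ) :
    falseDiscoveryProportion S₀ (knockoffSelect q W) ≤
      q * ∑ j with j ∈ S₀, (if 0 < W j then leaveOneOutWeight S₀ q W j else 0) := by
  have hnn : ∀ j, 0 ≤ if 0 < W j then leaveOneOutWeight S₀ q W j else 0 := fun j => by
    split_ifs
    · exact leaveOneOutWeight_nonneg ..
    · exact le_rfl
  rcases knockoffThreshold_eq_top_or q W with hT | ⟨t, hT, ht, -, hfdp⟩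
  · have : knockoffSelect q W = ∅ := by
      simp [knockoffSelect, hT]
    rw [this]
    simpa [falseDiscoveryProportion] using mul_nonneg hq (Finset.sum_nonneg fun j _ => hnn j)
  have hsel : knockoffSelect q W = Finset.univ.filter fun j => t ≤ W j := by
    simp [knockoffSelect, hT]
  set R : ℝ := ((max (Finset.univ.filter fun j => t ≤ W j).card 1 : ℕ) : ℝ) with hR
  have hRpos : 0 < R := by
    rw [hR]; exact_mod_cast lt_of_lt_of_le Nat.one_pos (le_max_right _ _)
  set S := (Finset.univ.filter fun j => t ≤ W j).filter fun j => j ∈ S₀ with hS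
  set M : ℝ := 1 + ((Finset.univ.filter fun j => W j ≤ -t).card : ℝ) with hM
  have hMpos : 0 < M := by positivity
  have hMR : M / R ≤ q := hfdp
  have hw : ∀ j ∈ S, 1 / M ≤ if 0 < W j then leaveOneOutWeight S₀ q W j else 0 := fun j hj => by
    simp only [hS, Finset.mem_filter, Finset.mem_univ, true_and] at hj
    have hj0 : 0 < W j := ht.trans_le hj.1
    have hTj : leaveOneOutThreshold q W j = t := by
      rw [leaveOneOutThreshold, abs_of_pos hj0, Function.update_eq_self, hT]
    rw [if_pos hj0, leaveOneOutWeight, hTj, abs_of_pos hj0, if_pos (by exact_mod_cast hj.1)]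
    refine one_div_le_one_div_of_le (by positivity) ?_
    rw [hM]
    gcongr with k
    rintro ⟨-, -, h⟩
    exact_mod_cast h
  calc falseDiscoveryProportion S₀ (knockoffSelect q W) = S.card / R := by
        rw [falseDiscoveryProportion, hsel]
    _ = (M / R) * (S.card * (1 / M)) := by field_simp
    _ ≤ q * (S.card * (1 / M)) := by gcongr
    _ = q * ∑ _j ∈ S, 1 / M := by rw [Finset.sum_const, nsmul_eq_mul]
    _ ≤ q * ∑ j ∈ S, (if 0 < W j then leaveOneOutWeight S₀ q W j else 0) := by
        gcongr with j hj
        exact hw j hj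
    _ ≤ _ := by
        refine mul_le_mul_of_nonneg_left
          (Finset.sum_le_sum_of_subset_of_nonneg (fun j => ?_) fun j _ _ => hnn j) hq
        simp [hS]

end Threshold

/-! ### Measurability of the selection procedure -/

section Measurability

variable {p : ℕ}

lemma measurable_card_filter {α ι : Type*} [MeasurableSpace α] [Fintype ι] {r : α → ι → Prop}
    [∀ a, DecidablePred (r a)] (h : ∀ i, MeasurableSet {a | r a i}) :
    Measurable fun a => (Finset.univ.filter fun i => r a i).card := by
  simp_rw [Finset.card_filter]
  exact Finset.measurable_sum _ fun i _ => Measurable.ite (h i) measurable_const measurable_const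

lemma measurable_fdpHat {α : Type*} [MeasurableSpace α] {W : α → Fin p → ℝ} {t : α → ℝ}
    (hW : Measurable W) (ht : Measurable t) : Measurable fun a => fdpHat (W a) (t a) := by
  classical
  have h1 : Measurable fun a => (Finset.univ.filter fun j => W a j ≤ -t a).card :=
    measurable_card_filter fun i => measurableSet_le (by fun_prop) (by fun_prop)
  have h2 : Measurable fun a => (Finset.univ.filter fun j => t a ≤ W a j).card :=
    measurable_card_filter fun i => measurableSet_le (by fun_prop) (by fun_prop)
  have h3 : Measurable fun k : ℕ => (k : ℝ) := measurable_from_top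
  unfold fdpHat
  exact ((h3.comp h1).const_add 1).div (h3.comp (h2.max (measurable_const (a := 1))))

lemma measurable_knockoffThreshold (q : ℝ) :
    Measurable (knockoffThreshold q : (Fin p → ℝ) → EReal) := by
  classical
  -- A finite infimum indexed by coordinates, with infeasible levels sent to `⊤`, replaces the
  -- infimum over a `W`-dependent set.
  have : (knockoffThreshold q : (Fin p → ℝ) → EReal) = fun W =>
      ⨅ i, if |W i| ≠ 0 ∧ fdpHat W |W i| ≤ q then ((|W i| : ℝ) : EReal) else ⊤ := by
    ext W
    refine le_antisymm (le_iInf fun i => ?_) (le_sInf ?_)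
    · split_ifs with h
      · exact sInf_le ⟨_, ⟨⟨⟨i, rfl⟩, h.1⟩, h.2⟩, rfl⟩
      · exact le_top
    · rintro _ ⟨t, ⟨⟨⟨i, rfl⟩, h0⟩, h⟩, rfl⟩
      exact (iInf_le _ i).trans_eq (if_pos ⟨h0, h⟩)
  rw [this]
  refine Measurable.iInf fun i => ?_
  have hi : Measurable fun W : Fin p → ℝ => |W i| := (measurable_pi_apply i).abs
  refine Measurable.ite ?_ hi.coe_real_ereal measurable_const
  exact (hi (measurableSet_singleton 0)).compl.inter
    (measurableSet_le (measurable_fdpHat measurable_id hi) measurable_const)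

lemma measurable_leaveOneOutWeight (S₀ : Set (Fin p)) (q : ℝ) (j : Fin p) :
    Measurable fun W : Fin p → ℝ => leaveOneOutWeight S₀ q W j := by
  classical
  have hj : Measurable fun W : Fin p → ℝ => |W j| := (measurable_pi_apply j).abs
  have hT : Measurable fun W : Fin p → ℝ => leaveOneOutThreshold q W j :=
    (measurable_knockoffThreshold q).comp (measurable_update'.comp (measurable_id.prodMk hj))
  have h3 : Measurable fun k : ℕ => 1 / (1 + (k : ℝ)) := measurable_from_top
  have h4 : Measurable fun W : Fin p → ℝ => (Finset.univ.filter fun k =>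
      k ∈ S₀ ∧ k ≠ j ∧ (W k : EReal) ≤ -leaveOneOutThreshold q W j).card :=
    measurable_card_filter fun k => (MeasurableSet.const _).inter ((MeasurableSet.const _).inter
      (measurableSet_le (measurable_pi_apply k).coe_real_ereal hT.neg))
  unfold leaveOneOutWeight
  refine Measurable.ite (measurableSet_le hT hj.coe_real_ereal) ?_ measurable_const
  exact h3.comp h4

lemma measurable_falseDiscoveryProportion_knockoffSelect (S₀ : Set (Fin p)) (q : ℝ) :
    Measurable fun W : Fin p → ℝ => falseDiscoveryProportion S₀ (knockoffSelect q W) := by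
  classical
  have h1 : ∀ j, MeasurableSet {W : Fin p → ℝ | knockoffThreshold q W ≤ (W j : EReal)} := fun j =>
    measurableSet_le (measurable_knockoffThreshold q) (measurable_pi_apply j).coe_real_ereal
  have h2 : Measurable fun W : Fin p → ℝ => (Finset.univ.filter fun j =>
      knockoffThreshold q W ≤ (W j : EReal) ∧ j ∈ S₀).card :=
    measurable_card_filter fun j => (h1 j).inter (MeasurableSet.const _)
  have h3 : Measurable fun k : ℕ => (k : ℝ) := measurable_from_top
  unfold falseDiscoveryProportion knockoffSelect
  simp_rw [Finset.filter_filter]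
  exact (h3.comp h2).div (h3.comp ((measurable_card_filter h1).max (measurable_const (a := 1))))

end Measurability

/-! ### From reflection to a false discovery rate bound -/

section FDR

open scoped ENNReal

variable {p : ℕ}

lemma falseDiscoveryProportion_nonneg (S₀ : Set (Fin p)) (S : Finset (Fin p)) :
    0 ≤ falseDiscoveryProportion S₀ S := by
  unfold falseDiscoveryProportion
  positivity

lemma falseDiscoveryProportion_le_one (S₀ : Set (Fin p)) (S : Finset (Fin p)) :
    falseDiscoveryProportion S₀ S ≤ 1 := by
  classical
  unfold falseDiscoveryProportion
  refine div_le_one_of_le₀ (Nat.cast_le.2 ?_) (by positivity)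
  exact (Finset.card_filter_le _ _).trans (le_max_left _ _)

/-- The leave-one-out bound on the false discovery proportion, on an event `A` on which reflecting
the positive values of each null statistic to negative ones does not decrease the mass. -/
lemma lintegral_indicator_falseDiscoveryProportion_le {E : Type*} [MeasurableSpace E]
    (ν : Measure E) [IsProbabilityMeasure ν] (S₀ : Set (Fin p)) {q : ℝ} (hq : 0 ≤ q) {A : Set E}
    (hA : MeasurableSet A) {W : E → Fin p → ℝ} (hW : Measurable W) (R : Fin p → E → E)
    (hRm : ∀ j, Measurable (R j))
    (hRA : ∀ j ∈ S₀, ∀ x, R j x ∈ A ↔ x ∈ A)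
    (hRW : ∀ j ∈ S₀, ∀ x, W (R j x) = Function.update (W x) j (-W x j))
    (hR : ∀ j ∈ S₀, ∀ f : E → ℝ≥0∞, Measurable f → (∀ x, f x ≠ 0 → x ∈ A ∧ 0 < W x j) →
      ∫⁻ x, f x ∂ν ≤ ∫⁻ x, f (R j x) ∂ν) :
    ∫⁻ x, A.indicator
      (fun x => ENNReal.ofReal (falseDiscoveryProportion S₀ (knockoffSelect q (W x)))) x ∂ν ≤
      ENNReal.ofReal q := by
  classical
  let f : Fin p → E → ℝ≥0∞ := fun j x =>
    if x ∈ A ∧ 0 < W x j then ENNReal.ofReal (leaveOneOutWeight S₀ q (W x) j) else 0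
  have hf : ∀ j, Measurable (f j) := fun j => by
    have hWj : Measurable fun x => W x j := by fun_prop
    refine Measurable.ite (hA.inter (measurableSet_lt measurable_const hWj)) ?_ measurable_const
    exact ((measurable_leaveOneOutWeight S₀ q j).comp hW).ennreal_ofReal
  have hfR : ∀ j ∈ S₀, ∀ x, f j (R j x) =
      if x ∈ A ∧ W x j < 0 then ENNReal.ofReal (leaveOneOutWeight S₀ q (W x) j) else 0 :=
    fun j hj x => by
      simp only [f, hRA j hj, hRW j hj, leaveOneOutWeight_update_neg, Function.update_self,
        Left.neg_pos_iff]
  have hle : ∀ x, A.indicator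
      (fun x => ENNReal.ofReal (falseDiscoveryProportion S₀ (knockoffSelect q (W x)))) x ≤
      ENNReal.ofReal q * ∑ j with j ∈ S₀, f j x := fun x => by
    by_cases hx : x ∈ A
    · rw [Set.indicator_of_mem hx]
      refine (ENNReal.ofReal_le_ofReal
        (falseDiscoveryProportion_le_sum_leaveOneOutWeight S₀ hq (W x))).trans_eq ?_
      rw [ENNReal.ofReal_mul hq, ENNReal.ofReal_sum_of_nonneg]
      · congr 1
        refine Finset.sum_congr (by congr!) fun j _ => ?_
        by_cases h : 0 < W x j <;> simp [f, hx, h]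
      · intro j _
        split_ifs
        · exact leaveOneOutWeight_nonneg ..
        · exact le_rfl
    · simp [hx]
  have hsum : ∀ x, ∑ j with j ∈ S₀, f j (R j x) ≤ 1 := fun x => by
    rw [Finset.sum_congr rfl fun j hj => hfR j (by simpa using hj) x]
    by_cases hx : x ∈ A
    · rw [← ENNReal.ofReal_one]
      refine le_trans (le_of_eq ?_)
        (ENNReal.ofReal_le_ofReal (sum_leaveOneOutWeight_neg_le_one S₀ q (W x)))
      rw [ENNReal.ofReal_sum_of_nonneg]
      · refine Finset.sum_congr (by congr!) fun j _ => ?_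
        by_cases h : W x j < 0 <;> simp [hx, h]
      · intro j _
        split_ifs
        · exact leaveOneOutWeight_nonneg ..
        · exact le_rfl
    · simp [hx]
  calc _ ≤ ∫⁻ x, ENNReal.ofReal q * ∑ j with j ∈ S₀, f j x ∂ν := lintegral_mono hle
    _ = ENNReal.ofReal q * ∑ j with j ∈ S₀, ∫⁻ x, f j x ∂ν := by
      rw [lintegral_const_mul _ (Finset.measurable_sum _ fun j _ => hf j),
        lintegral_finsetSum _ fun j _ => hf j]
    -- The only probabilistic step: each null summand is reflected separately by its own `R j`.
    _ ≤ ENNReal.ofReal q * ∑ j with j ∈ S₀, ∫⁻ x, f j (R j x) ∂ν := by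
      refine mul_le_mul_right (Finset.sum_le_sum fun j hj => ?_) _
      refine hR j (by simpa using hj) _ (hf j) fun x hx => ?_
      by_contra h
      exact hx (if_neg h)
    _ = ENNReal.ofReal q * ∫⁻ x, ∑ j with j ∈ S₀, f j (R j x) ∂ν := by
      rw [lintegral_finsetSum (f := fun j x => f j (R j x)) _ fun j _ => (hf j).comp (hRm j)]
    _ ≤ ENNReal.ofReal q * ∫⁻ _, 1 ∂ν := by
      gcongr with x
      exact hsum x
    _ = ENNReal.ofReal q := by simp

lemma integral_falseDiscoveryProportion_le {E : Type*} [MeasurableSpace E]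
    (ν : Measure E) [IsProbabilityMeasure ν] (S₀ : Set (Fin p)) {q : ℝ} (hq : 0 ≤ q) {A : Set E}
    (hA : MeasurableSet A) {W : E → Fin p → ℝ} (hW : Measurable W)
    (h : ∫⁻ x, A.indicator
      (fun x => ENNReal.ofReal (falseDiscoveryProportion S₀ (knockoffSelect q (W x)))) x ∂ν ≤
      ENNReal.ofReal q) :
    ∫ x, falseDiscoveryProportion S₀ (knockoffSelect q (W x)) ∂ν ≤ q + ν.real Aᶜ := by
  have hm : Measurable fun x => falseDiscoveryProportion S₀ (knockoffSelect q (W x)) :=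
    (measurable_falseDiscoveryProportion_knockoffSelect S₀ q).comp hW
  have hle : ∫⁻ x, ENNReal.ofReal (falseDiscoveryProportion S₀ (knockoffSelect q (W x))) ∂ν ≤
      ENNReal.ofReal q + ν Aᶜ := by
    rw [← lintegral_add_compl _ hA]
    refine add_le_add ?_ ?_
    · rwa [lintegral_indicator hA] at h
    · calc _ ≤ ∫⁻ _ in Aᶜ, 1 ∂ν := lintegral_mono fun x => by
            simpa using falseDiscoveryProportion_le_one _ _
        _ = ν Aᶜ := by simp
  rw [integral_eq_lintegral_of_nonneg_ae
    (ae_of_all _ fun x => falseDiscoveryProportion_nonneg _ _) hm.aestronglyMeasurable]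
  refine (ENNReal.toReal_mono (by finiteness) hle).trans_eq ?_
  rw [ENNReal.toReal_add (by finiteness) (by finiteness), ENNReal.toReal_ofReal hq]
  rfl

end FDR

/-! ### Geometry of least squares with knockoffs -/

section LinearModel

open scoped RealInnerProductSpace Matrix

variable {n p : ℕ} {X Xk : Matrix (Fin n) (Fin p) ℝ}

lemma olsEstimate_add {κ : Type*} [Fintype κ] [DecidableEq κ] (A : Matrix (Fin n) κ ℝ)
    (y z : Fin n → ℝ) : olsEstimate A (y + z) = olsEstimate A y + olsEstimate A z := by
  simp [olsEstimate, Matrix.mulVec_add]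

lemma olsEstimate_mulVec {κ : Type*} [Fintype κ] [DecidableEq κ] {A : Matrix (Fin n) κ ℝ}
    (hA : IsUnit (Aᵀ * A).det) (v : κ → ℝ) : olsEstimate A (A *ᵥ v) = v := by
  rw [olsEstimate, Matrix.mulVec_mulVec, Matrix.mulVec_mulVec, Matrix.mul_assoc,
    Matrix.nonsing_inv_mul _ hA, Matrix.one_mulVec]

lemma gram_mulVec_olsEstimate {κ : Type*} [Fintype κ] [DecidableEq κ] {A : Matrix (Fin n) κ ℝ}
    (hA : IsUnit (Aᵀ * A).det) (y : Fin n → ℝ) : (Aᵀ * A) *ᵥ olsEstimate A y = Aᵀ *ᵥ y := by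
  rw [olsEstimate, Matrix.mulVec_mulVec, Matrix.mul_nonsing_inv _ hA, Matrix.one_mulVec]

lemma measurable_olsEstimate {κ : Type*} [Fintype κ] [DecidableEq κ] (A : Matrix (Fin n) κ ℝ) :
    Measurable (olsEstimate A) := by
  have : olsEstimate A = fun y => ((Aᵀ * A)⁻¹ * Aᵀ).mulVecLin y := by
    funext y
    rw [olsEstimate, Matrix.mulVec_mulVec, Matrix.mulVecLin_apply]
  rw [this]
  exact (LinearMap.continuous_of_finiteDimensional _).measurable

/-- The contrast `e_j - e_{j + p}` between a feature and its knockoff. -/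
def pairContrast (j : Fin p) : Fin p ⊕ Fin p → ℝ :=
  Pi.single (Sum.inl j) 1 - Pi.single (Sum.inr j) 1

/-- The column `j` of the design minus its knockoff column. -/
def columnContrast (X Xk : Matrix (Fin n) (Fin p) ℝ) (j : Fin p) : EuclideanSpace ℝ (Fin n) :=
  WithLp.toLp 2 (augmentedDesign X Xk *ᵥ pairContrast j)

lemma solsEstimate_response (hG : IsUnit (augmentedGram X Xk).det) (β δ' : Fin p → ℝ)
    (x : EuclideanSpace ℝ (Fin n)) :
    solsEstimate X Xk δ' (response X β x) =
      Sum.elim β δ' + olsEstimate (augmentedDesign X Xk) x.ofLp := by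
  have h : response X β x = augmentedDesign X Xk *ᵥ Sum.elim β 0 + x.ofLp := by
    ext i
    simp [response, augmentedDesign, Matrix.fromCols_mulVec]
  rw [solsEstimate, h, olsEstimate_add, olsEstimate_mulVec hG]
  ext (i | i) <;> simp [add_comm]

lemma inner_columnContrast {s : Fin p → ℝ} (hXk : IsKnockoff X Xk s)
    (hG : IsUnit (augmentedGram X Xk).det) (j : Fin p) (x : EuclideanSpace ℝ (Fin n)) :
    ⟪columnContrast X Xk j, x⟫ = s j * (olsEstimate (augmentedDesign X Xk) x.ofLp (Sum.inl j) -
      olsEstimate (augmentedDesign X Xk) x.ofLp (Sum.inr j)) := by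
  -- The blocks of `G` differ only by `diag s`, so the contrast is an eigenvector.
  have hrow : pairContrast j ᵥ* augmentedGram X Xk = s j • pairContrast j := by
    rw [hXk.gram]
    ext (k | k) <;>
      simp [pairContrast, Matrix.sub_vecMul, Matrix.diagonal_apply, Pi.single_apply, eq_comm]
  calc ⟪columnContrast X Xk j, x⟫
      = (augmentedDesign X Xk *ᵥ pairContrast j) ⬝ᵥ x.ofLp := by
        simp [columnContrast, EuclideanSpace.inner_eq_star_dotProduct, dotProduct_comm]
    _ = pairContrast j ⬝ᵥ ((augmentedDesign X Xk)ᵀ *ᵥ x.ofLp) := by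
        rw [Matrix.dotProduct_mulVec, Matrix.vecMul_transpose]
    _ = (pairContrast j ᵥ* augmentedGram X Xk) ⬝ᵥ
          olsEstimate (augmentedDesign X Xk) x.ofLp := by
        rw [← gram_mulVec_olsEstimate hG, Matrix.dotProduct_mulVec]
        rfl
    _ = _ := by
        rw [hrow, smul_dotProduct, pairContrast, sub_dotProduct]
        simp

lemma columnContrast_ne_zero (hG : IsUnit (augmentedGram X Xk).det) (j : Fin p) :
    columnContrast X Xk j ≠ 0 := fun h => by
  have h0 : augmentedDesign X Xk *ᵥ pairContrast j = 0 := congrArg WithLp.ofLp h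
  have h1 := olsEstimate_mulVec hG (pairContrast j)
  rw [h0] at h1
  have := congrFun h1 (Sum.inl j)
  simp [olsEstimate, pairContrast] at this

lemma olsEstimate_inl_sub_inr {s : Fin p → ℝ} (hXk : IsKnockoff X Xk s)
    (hG : IsUnit (augmentedGram X Xk).det) (j : Fin p) (x : EuclideanSpace ℝ (Fin n)) :
    olsEstimate (augmentedDesign X Xk) x.ofLp (Sum.inl j) -
      olsEstimate (augmentedDesign X Xk) x.ofLp (Sum.inr j) =
      2 * (⟪columnContrast X Xk j, x⟫ / ‖columnContrast X Xk j‖ ^ 2) := by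
  -- Regressing the column contrast returns the coefficients `1` and `-1`, whose difference is `2`.
  have h : ‖columnContrast X Xk j‖ ^ 2 = s j * 2 := by
    rw [← real_inner_self_eq_norm_sq, inner_columnContrast hXk hG]
    simp only [columnContrast]
    rw [olsEstimate_mulVec hG]
    simp [pairContrast]
    left; norm_num
  have hne : ‖columnContrast X Xk j‖ ^ 2 ≠ 0 := by
    have := columnContrast_ne_zero hG j
    positivity
  have hs : s j ≠ 0 := fun h0 => hne (by rw [h, h0, zero_mul])
  rw [h, inner_columnContrast hXk hG]
  field_simp

lemma solsEstimate_sub_smul_columnContrast (hG : IsUnit (augmentedGram X Xk).det)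
    (β δ' : Fin p → ℝ) (j : Fin p) (x : EuclideanSpace ℝ (Fin n)) (c : ℝ) :
    solsEstimate X Xk δ' (response X β (x - c • columnContrast X Xk j)) =
      solsEstimate X Xk δ' (response X β x) - c • pairContrast j := by
  rw [solsEstimate_response hG, solsEstimate_response hG]
  have : (x - c • columnContrast X Xk j).ofLp =
      x.ofLp + augmentedDesign X Xk *ᵥ (-c • pairContrast j) := by
    rw [Matrix.mulVec_smul, neg_smul, ← sub_eq_add_neg]
    rfl
  rw [this, olsEstimate_add, olsEstimate_mulVec hG, neg_smul, ← add_assoc, ← sub_eq_add_neg]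

lemma swapPairs_singleton_eq (j : Fin p) (c : Fin p ⊕ Fin p → ℝ) :
    swapPairs {j} c = c - (c (Sum.inl j) - c (Sum.inr j)) • pairContrast j := by
  ext (k | k) <;> rcases eq_or_ne k j with rfl | h <;> simp [swapPairs, pairContrast, *]

/-- Common source of both parts of the theorem, which differ only in `W`, `S₀` and the good event
`A`. -/
lemma knockoffFDR_solsEstimate_le {Ω : Type*} [MeasurableSpace Ω] (P : Measure Ω)
    [IsProbabilityMeasure P] {s : Fin p → ℝ} (hXk : IsKnockoff X Xk s)
    (hG : IsUnit (augmentedGram X Xk).det) (β : Fin p → ℝ) (σ : ℝ)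
    (w : Ω → EuclideanSpace ℝ (Fin n))
    (hw : HasLaw w (multivariateGaussian 0 (σ ^ 2 • (1 : Matrix (Fin n) (Fin n) ℝ))) P)
    {q : ℝ} (hq : 0 ≤ q) (δ' : Fin p → ℝ) (S₀ : Set (Fin p)) (hS₀ : ∀ j ∈ S₀, β j ≤ δ' j)
    {W : (Fin p ⊕ Fin p → ℝ) → Fin p → ℝ} (hW : Measurable W) (hanti : IsAntisymmetric W)
    {A : Set (Fin p ⊕ Fin p → ℝ)} (hA : MeasurableSet A)
    (hAswap : ∀ j ∈ S₀, ∀ c, swapPairs {j} c ∈ A ↔ c ∈ A)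
    (hpos : ∀ c ∈ A, ∀ j ∈ S₀, 0 < W c j → 0 < c (Sum.inl j) - c (Sum.inr j)) :
    knockoffFDR P S₀ q (fun ω => W (solsEstimate X Xk δ' (response X β (w ω)))) ≤
      q + P.real {ω | solsEstimate X Xk δ' (response X β (w ω)) ∉ A} := by
  set ν := multivariateGaussian 0 (σ ^ 2 • (1 : Matrix (Fin n) (Fin n) ℝ)) with hν
  let B : EuclideanSpace ℝ (Fin n) → Fin p ⊕ Fin p → ℝ := fun x =>
    solsEstimate X Xk δ' (response X β x)
  have hB : Measurable B := by
    have : B = fun x => Sum.elim β δ' + olsEstimate (augmentedDesign X Xk) x.ofLp :=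
      funext fun x => solsEstimate_response hG β δ' x
    rw [this]
    have h := measurable_olsEstimate (augmentedDesign X Xk)
    fun_prop
  have hS : (σ ^ 2 • (1 : Matrix (Fin n) (Fin n) ℝ)).PosSemidef :=
    Matrix.PosSemidef.one.smul (sq_nonneg σ)
  have hdiff : ∀ j x, B x (Sum.inl j) - B x (Sum.inr j) = (β j - δ' j) +
      2 * (⟪columnContrast X Xk j, x⟫ / ‖columnContrast X Xk j‖ ^ 2) := fun j x => by
    simp only [B]
    rw [← olsEstimate_inl_sub_inr hXk hG, solsEstimate_response hG]
    simp
    ring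
  -- The coefficient is the current gap between the two estimates (`hdiff`); moving the noise back
  -- by that multiple of the contrast swaps them.
  let R : Fin p → EuclideanSpace ℝ (Fin n) → EuclideanSpace ℝ (Fin n) := fun j x =>
    x - ((β j - δ' j) + 2 * (⟪columnContrast X Xk j, x⟫ / ‖columnContrast X Xk j‖ ^ 2)) •
      columnContrast X Xk j
  have hBR : ∀ j x, B (R j x) = swapPairs {j} (B x) := fun j x => by
    rw [swapPairs_singleton_eq, hdiff]
    exact solsEstimate_sub_smul_columnContrast hG β δ' j x _
  have hmain := integral_falseDiscoveryProportion_le ν S₀ hq (hB hA) (hW.comp hB)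
    (lintegral_indicator_falseDiscoveryProportion_le ν S₀ hq (hB hA) (hW.comp hB) R
      (fun j => by fun_prop)
      (fun j hj x => by
        simp only [Set.mem_preimage, hBR]
        exact hAswap j hj _)
      (fun j hj x => by
        ext k
        simp only [Function.comp_apply, hBR, hanti {j} (B x) k]
        rcases eq_or_ne k j with rfl | h <;> simp [*])
      (fun j hj f hf hsupp => by
        refine lintegral_le_lintegral_comp_reflection ν (σ ^ 2) ?_ (fun x y => ?_)
          (columnContrast_ne_zero hG j) (sub_nonpos.2 (hS₀ j hj)) hf fun x hx => ?_
        · rw [hν, integral_id_multivariateGaussian]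
        · rw [hν, covarianceBilin_multivariateGaussian hS]
          simp [EuclideanSpace.inner_eq_star_dotProduct, Matrix.smul_mulVec, dotProduct_comm]
        · rw [← hdiff]
          exact hpos _ (hsupp x hx).1 j hj (hsupp x hx).2))
  have hm : Measurable fun x => falseDiscoveryProportion S₀ (knockoffSelect q (W (B x))) :=
    (measurable_falseDiscoveryProportion_knockoffSelect S₀ q).comp (hW.comp hB)
  have e1 : knockoffFDR P S₀ q (fun ω => W (B (w ω))) =
      ∫ x, falseDiscoveryProportion S₀ (knockoffSelect q (W (B x))) ∂ν := by
    rw [← hw.map_eq, integral_map hw.aemeasurable hm.aestronglyMeasurable]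
    rfl
  have e2 : P.real {ω | B (w ω) ∉ A} = ν.real (B ⁻¹' A)ᶜ := by
    rw [← hw.map_eq, map_measureReal_apply_of_aemeasurable hw.aemeasurable (hB hA).compl]
    rfl
  exact e1.trans_le (hmain.trans_eq (by rw [← e2]))

end LinearModel

/-! ### The two false discovery rate bounds -/

theorem mainTheorem1 {Ω : Type*} [MeasurableSpace Ω] (P : Measure Ω) [IsProbabilityMeasure P]
    {n p : ℕ} (X Xk : Matrix (Fin n) (Fin p) ℝ) (s : Fin p → ℝ) (hXk : IsKnockoff X Xk s)
    (hG : IsUnit (augmentedGram X Xk).det)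
    (β : Fin p → ℝ) (σ : ℝ) (w : Ω → EuclideanSpace ℝ (Fin n))
    (hw : HasLaw w (multivariateGaussian 0 (σ ^ 2 • (1 : Matrix (Fin n) (Fin n) ℝ))) P)
    (q : ℝ) (hq : q ∈ Set.Icc (0 : ℝ) 1) (δ : ℝ) (hδ : 0 ≤ δ)
    (δ' : Fin p → ℝ) (hδ' : ∀ i, δ ≤ δ' i)
    (b : Ω → Fin p ⊕ Fin p → ℝ)
    (hb : ∀ ω, b ω = solsEstimate X Xk δ' (response X β (w ω))) :
    knockoffFDR P {j | β j ≤ δ} q (fun ω j => b ω (Sum.inl j) - b ω (Sum.inr j)) ≤ q ∧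
    ∀ W : (Fin p ⊕ Fin p → ℝ) → Fin p → ℝ, Measurable W → IsAntisymmetric W →
      (∀ c j, SignType.sign (W c j) = SignType.sign (|c (Sum.inl j)| - |c (Sum.inr j)|)) →
      knockoffFDR P {j | |β j| ≤ δ} q (fun ω => W (b ω)) ≤
        q + P.real {ω | minOver {j | |β j| ≤ δ}
          (fun j => b ω (Sum.inl j) + b ω (Sum.inr j)) < 0} := by
  obtain rfl : b = fun ω => solsEstimate X Xk δ' (response X β (w ω)) := funext hb
  refine ⟨?_, fun W hW hanti hsign => ?_⟩
  · have h := knockoffFDR_solsEstimate_le P hXk hG β σ w hw hq.1 δ' {j | β j ≤ δ}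
      (fun j hj => le_trans hj (hδ' j)) (W := fun c j => c (Sum.inl j) - c (Sum.inr j))
      (by fun_prop)
      (fun F c i => by by_cases hi : i ∈ F <;> simp [swapPairs, hi])
      MeasurableSet.univ (fun _ _ _ => Iff.rfl) (fun _ _ _ _ h => h)
    simpa using h
  · set S₀ : Set (Fin p) := {j | |β j| ≤ δ} with hS₀
    have hset : ∀ c : Fin p ⊕ Fin p → ℝ,
        minOver S₀ (fun j => c (Sum.inl j) + c (Sum.inr j)) < 0 ↔
          c ∉ {c : Fin p ⊕ Fin p → ℝ | ∀ j ∈ S₀, 0 ≤ c (Sum.inl j) + c (Sum.inr j)} := fun c => by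
      simp only [minOver, iInf_lt_iff, Set.mem_ofPred_eq, not_forall, not_le, exists_prop]
      refine exists_congr fun j => and_congr_right fun _ => ?_
      exact_mod_cast Iff.rfl
    simp only [hset]
    refine knockoffFDR_solsEstimate_le P hXk hG β σ w hw hq.1 δ' S₀
      (fun j hj => (le_abs_self _).trans (le_trans hj (hδ' j))) hW hanti ?_ ?_ ?_
    · simp only [Set.ofPred_forall]
      exact MeasurableSet.iInter fun j => MeasurableSet.iInter fun _ =>
        measurableSet_le measurable_const (by fun_prop)
    · intro j _ c
      refine forall₂_congr fun k _ => ?_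
      by_cases hk : k = j <;> simp [swapPairs, hk, add_comm]
    · intro c hc j hj h
      have h1 := hsign c j
      rw [sign_pos h, eq_comm, sign_eq_one_iff, sub_pos] at h1
      have h2 := hc j hj
      -- If the first estimate were at most the second, a nonnegative sum would bound its absolute
      -- value by the second, contradicting `h1`.
      by_contra! h3
      refine absurd h1 (not_lt.2 (abs_le.2 ⟨?_, ?_⟩)) <;>
        linarith [le_abs_self (c (Sum.inr j))]
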